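/- Throughout, categories have Hom-sets, and "products" means products of families indexed by sets. The objects of a category form a class, in a set theory in which the universe of all sets can be well-ordered; thus the isomorphism classes of objects of any category can be indexed by the ordinals. (Formally: sets are the elements of a fixed universe, and the objects of the category $\mathcal{B}$ below are assumed to be indexed, up to isomorphism, by the ordinals of that universe.) For an additive category $\mathcal{B}$ let $\mathbf{K}(\mathcal{B})$ be the homotopy category of unbounded cochain complexes over $\mathcal{B}$, with its usual triangulated structure. A triangulated category $\mathcal{T}$ with products *satisfies Brown representability for the dual* if every homological functor $F\colon \mathcal{T}\to \mathrm{Ab}$ which sends products in $\mathcal{T}$ to products of abelian groups is naturally isomorphic to $\mathcal{T}(Y,-)$ for some object $Y\in\mathcal{T}$. If $\mathcal{B}$ has products and $X\in\mathcal{B}$, let $\mathrm{Prod}(X)$ be the closure of $\{X\}$ in $\mathcal{B}$ under products and direct summands; $\mathcal{B}$ *has a product generator* if $\mathcal{B}=\mathrm{Prod}(X)$ for some $X\in\mathcal{B}$. **Theorem.** Let $\mathcal{B}$ be an additive category with products. If $\mathbf{K}(\mathcal{B})$ satisfies Brown representability for the dual, then $\mathcal{B}$ has a product generator. Moreover, the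 category $\mathrm{Ab}$ of abelian groups has no product generator; in particular, $\mathbf{K}(\mathrm{Ab})$ does not satisfy Brown representability for the dual. -/

import Mathlib

open CategoryTheory CategoryTheory.Limits

universe v u

/-- "Sets" are the `v`-small types and `T` has `v`-small Hom-sets. A category `T` with a
triangulated structure satisfies *Brown representability for the dual* if every
homological functor `F : T ⥤ Ab` which sends products (indexed by sets) to products is
naturally isomorphic to `T(Y, -)` for some object `Y` of `T`. -/
def BrownRepresentabilityForDual (T : Type u) [Category.{v} T] [Preadditive T]
    [HasZeroObject T] [HasShift T ℤ] [∀ n : ℤ, (shiftFunctor T n).Additive]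
    [Pretriangulated T] : Prop :=
  ∀ F : T ⥤ AddCommGrpCat.{v}, F.IsHomological →
    (∀ J : Type v, PreservesLimitsOfShape (Discrete J) F) →
      ∃ Y : T, Nonempty (F ≅ preadditiveCoyoneda.obj (Opposite.op Y))

/-- `ProdClosure U` is the closure `Prod(U)` of the class of objects `U` under products
indexed by sets and under direct summands. -/
inductive ProdClosure {B : Type u} [Category.{v} B] [Preadditive B] [HasBinaryBiproducts B]
    (U : ObjectProperty B) : B → Prop
  | of_mem {X : B} (hX : U X) : ProdClosure U X
  | product {J : Type v} {f : J → B} (c : Fan f) (hc : IsLimit c)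
      (hf : ∀ j, ProdClosure U (f j)) : ProdClosure U c.pt
  | summand {Z M N : B} (e : Z ≅ M ⊞ N) (hZ : ProdClosure U Z) : ProdClosure U M

/-- `B` has a *product generator*: an object `X` with `B = Prod(X)`. -/
def HasProductGenerator (B : Type u) [Category.{v} B] [Preadditive B]
    [HasBinaryBiproducts B] : Prop :=
  ∃ X : B, ∀ M : B, ProdClosure (fun Y => Y = X) M

/-- Up to isomorphism, the objects of `B` can be indexed by the ordinals of the universe of
sets. This says that `B` is a (locally small) category whose objects form a class, in a
set theory in which the universe of all sets can be well-ordered. -/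
def ObjectsIndexedByOrdinals (B : Type u) [Category.{v} B] : Prop :=
  ∃ f : Ordinal.{v} → B, ∀ X : B, ∃ α : Ordinal.{v}, Nonempty (f α ≅ X)

/-! Given `X`, each `M` starts a complex `M ⟶ P₁ ⟶ P₂ ⟶ ⋯`, with powers of `X` as further terms, on
which `Hom(-, X)` is exact. All its maps to complexes whose terms are retracts of `X` are
null-homotopic, and it is contractible only if `M ∈ Prod(X)`. Without a product generator, let `X`
grow through the ordinals and pick `M ∉ Prod(X)`: this gives a proper class of nonzero objects of
`K(B)`, of which only a set map nontrivially to any given complex. The product of all their Hom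
functors thus has small values, and an object representing it would receive nonzero maps from all of
them, a contradiction.

For `Ab`, rank the elements of `X` by the tree of their successive halvings. Transfinite gluing
gives a pointed group `(G, g)` such that `g` starts no infinite chain of halvings, while all its
images in `X` do. The latter property passes to `Prod(X)`, so `G ∉ Prod(X)`. -/

lemma equivShrink_zero' (A : Type*) [Zero A] [Small.{v} A] : equivShrink.{v} A 0 = 0 :=
  (Equiv.eq_symm_apply _).1 equivShrink_symm_zero.symm

/-! ### Products of a class of Hom functors -/

section CoyonedaProduct

universe w

variable {T : Type u} [Category.{v} T] [Preadditive T] {ι : Type w} (Y : ι → T)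

lemma small_pi_hom (Z : T) [Small.{v} {i // ∃ f : Y i ⟶ Z, f ≠ 0}] :
    Small.{v} (∀ i, Y i ⟶ Z) := by
  refine small_of_injective
    (β := ∀ i : {i // ∃ f : Y i ⟶ Z, f ≠ 0}, Y i ⟶ Z) (f := fun φ i => φ i) ?_
  intro φ ψ h
  funext i
  by_cases hi : ∃ f : Y i ⟶ Z, f ≠ 0
  · exact congrFun h ⟨i, hi⟩
  · push Not at hi
    rw [hi (φ i), hi (ψ i)]

/-- The functor `Z ↦ ∏ i, T(Y i, Z)`, provided that these products are essentially small. -/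
noncomputable def coyonedaProduct [∀ Z, Small.{v} (∀ i, Y i ⟶ Z)] : T ⥤ AddCommGrpCat.{v} where
  obj Z := AddCommGrpCat.of (Shrink.{v} (∀ i, Y i ⟶ Z))
  map g := AddCommGrpCat.ofHom
    { toFun := fun x => equivShrink _ fun i => (equivShrink _).symm x i ≫ g
      map_zero' := by
        rw [equivShrink_symm_zero, ← equivShrink_zero']
        congr 1; funext i; simp
      map_add' := fun x y => by
        rw [equivShrink_symm_add, ← equivShrink_add]
        congr 1; funext i; simp }
  map_id Z := by ext x; simp
  map_comp g h := by ext x; simp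

variable [∀ Z, Small.{v} (∀ i, Y i ⟶ Z)]

lemma coyonedaProduct_map_apply {Z W : T} (g : Z ⟶ W) (φ : ∀ i, Y i ⟶ Z) :
    (coyonedaProduct Y).map g (equivShrink _ φ) = equivShrink _ fun i => φ i ≫ g :=
  congrArg (equivShrink (∀ i, Y i ⟶ W)) (funext fun i => by
    rw [Equiv.symm_apply_apply])

instance [HasZeroObject T] [HasShift T ℤ] [∀ n : ℤ, (shiftFunctor T n).Additive]
    [Pretriangulated T] : (coyonedaProduct Y).IsHomological where
  map_zero Z W := by
    ext x
    obtain ⟨φ, rfl⟩ := (equivShrink _).surjective x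
    rw [coyonedaProduct_map_apply]
    simp only [comp_zero]
    exact equivShrink_zero' _
  exact D hD := by
    rw [ShortComplex.ab_exact_iff]
    intro x hx
    obtain ⟨φ, rfl⟩ := (equivShrink (∀ i, Y i ⟶ D.obj₂)).surjective x
    have hφ : (fun i => φ i ≫ D.mor₂) = 0 := by
      apply (equivShrink (∀ i, Y i ⟶ D.obj₃)).injective
      rw [equivShrink_zero']
      exact (coyonedaProduct_map_apply Y D.mor₂ φ).symm.trans hx
    choose ψ hψ using fun i => D.coyoneda_exact₂ hD (φ i) (congrFun hφ i)
    refine ⟨equivShrink _ ψ, (coyonedaProduct_map_apply Y D.mor₁ ψ).trans ?_⟩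
    exact congrArg _ (funext fun i => (hψ i).symm)

instance (J : Type v) : PreservesLimitsOfShape (Discrete J) (coyonedaProduct Y) := by
  suffices PreservesLimitsOfShape (Discrete J) (coyonedaProduct Y ⋙ forget AddCommGrpCat.{v}) from
    preservesLimitsOfShape_of_reflects_of_preserves _ (forget AddCommGrpCat.{v})
  refine ⟨fun {K} => ⟨fun {c} hc => (Types.isLimit_iff _).2 fun s hs => ?_⟩⟩
  choose φ hφ using fun j => (equivShrink (∀ i, Y i ⟶ K.obj j)).surjective (s j)
  let e (i : ι) : Cone K :=
    { pt := Y i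
      π := Discrete.natTrans fun j => φ j i }
  have key (x : ∀ i, Y i ⟶ c.pt) (j : Discrete J) :
      (((coyonedaProduct Y ⋙ forget AddCommGrpCat.{v}).mapCone c).π.app j) (equivShrink _ x) =
        equivShrink _ fun i => x i ≫ c.π.app j := coyonedaProduct_map_apply Y (c.π.app j) x
  refine ⟨equivShrink _ fun i => hc.lift (e i), fun j => ?_, fun y hy => ?_⟩
  · rw [key, ← hφ]
    exact congrArg _ (funext fun i => hc.fac (e i) j)
  · obtain ⟨x, rfl⟩ := (equivShrink (∀ i, Y i ⟶ c.pt)).surjective y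
    refine congrArg _ (funext fun i => hc.hom_ext fun j => ?_)
    have h := hy j
    rw [key, ← hφ] at h
    exact (congrFun ((equivShrink _).injective h) i).trans (hc.fac (e i) j).symm

end CoyonedaProduct

/-- If Brown representability for the dual holds, then a family of nonzero objects such that
every object receives nonzero maps only from a small subfamily admits an object that receives
nonzero maps from all its members. -/
theorem BrownRepresentabilityForDual.exists_forall_isZero
    {T : Type u} [Category.{v} T] [Preadditive T]
    [HasZeroObject T] [HasShift T ℤ] [∀ n : ℤ, (shiftFunctor T n).Additive]
    [Pretriangulated T] (hT : BrownRepresentabilityForDual T) {ι : Type*} (Y : ι → T)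
    (hY : ∀ Z, Small.{v} {i // ∃ f : Y i ⟶ Z, f ≠ 0}) :
    ∃ Z : T, ∀ i, (∀ f : Y i ⟶ Z, f = 0) → IsZero (Y i) := by
  classical
  have := fun Z => small_pi_hom Y Z
  obtain ⟨Z, ⟨e⟩⟩ := hT (coyonedaProduct Y) inferInstance inferInstance
  refine ⟨Z, fun i hi => ?_⟩
  rw [IsZero.iff_id_eq_zero]
  -- `ω` is the universal family of maps `Y j ⟶ Z`. Naturality along `g` gives `ω i ≫ g = 𝟙`, so `ω
  -- i = 0` forces `Y i = 0`.
  obtain ⟨ω, hω⟩ := (equivShrink (∀ j, Y j ⟶ Z)).surjective (e.inv.app Z (𝟙 Z))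
  let x : (coyonedaProduct Y).obj (Y i) := equivShrink _ (Pi.single i (𝟙 (Y i)))
  let g : Z ⟶ Y i := e.hom.app (Y i) x
  have h1 : e.inv.app (Y i) g = x := by
    change (e.hom.app (Y i) ≫ e.inv.app (Y i)) x = x
    simp
  have h2 : e.inv.app (Y i) g = (coyonedaProduct Y).map g (e.inv.app Z (𝟙 Z)) := by
    have h := ConcreteCategory.congr_hom (e.inv.naturality g) (𝟙 Z)
    change e.inv.app (Y i) (𝟙 Z ≫ g) = _ at h
    rw [Category.id_comp] at h
    exact h
  rw [h1, ← hω, coyonedaProduct_map_apply] at h2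
  have h3 := congrFun ((equivShrink _).injective h2) i
  rw [Pi.single_eq_same, hi (ω i), zero_comp] at h3
  exact h3

/-! ### Retracts and direct summands -/

section Retracts

variable {B : Type u} [Category.{v} B] [Preadditive B] [HasBinaryBiproducts B] [HasProducts.{v} B]

/-- Eilenberg swindle: if `M` is a retract of `P`, then `Pᴺ ≅ M ⊞ Pᴺ`. -/
noncomputable def CategoryTheory.Retract.powerIso {M P : B} (h : Retract M P) :
    (∏ᶜ fun _ : ULift.{v} ℕ => P) ≅ M ⊞ (∏ᶜ fun _ : ULift.{v} ℕ => P) where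
  -- The `M`-parts of the factors shift by one place; the complementary parts stay fixed.
  hom := biprod.lift (Pi.π _ ⟨0⟩ ≫ h.r) (Pi.lift fun k =>
    Pi.π _ ⟨k.down + 1⟩ ≫ h.r ≫ h.i + Pi.π _ k ≫ (𝟙 P - h.r ≫ h.i))
  inv := Pi.lift fun k => match k with
    | ⟨0⟩ => biprod.fst ≫ h.i + biprod.snd ≫ Pi.π _ ⟨0⟩ ≫ (𝟙 P - h.r ≫ h.i)
    | ⟨k + 1⟩ => biprod.snd ≫ (Pi.π _ ⟨k⟩ ≫ h.r ≫ h.i + Pi.π _ ⟨k + 1⟩ ≫ (𝟙 P - h.r ≫ h.i))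
  hom_inv_id := by
    refine Pi.hom_ext _ _ fun ⟨k⟩ => ?_
    cases k <;> simp
  inv_hom_id := by
    refine biprod.hom_ext _ _ ?_ (Pi.hom_ext _ _ fun ⟨k⟩ => ?_)
    · simp
    · cases k <;> simp

/-- Idempotents need not split in `B`, so `M` may lack a complement in `P`; it has one in a
countable power of `P`. -/
lemma ProdClosure.of_retract {U : ObjectProperty B} {M P : B} (h : Retract M P)
    (hP : ProdClosure U P) : ProdClosure U M :=
  .summand h.powerIso (.product _ (limit.isLimit _) fun _ => hP)

end Retracts

lemma exists_dependent_sequence {A : ℕ → Type*} (Q : ∀ n, A n → Prop)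
    (R : ∀ n, A n → A (n + 1) → Prop) (h0 : ∃ a, Q 0 a)
    (hs : ∀ n a, Q n a → ∃ b, Q (n + 1) b ∧ R n a b) :
    ∃ s : ∀ n, A n, ∀ n, R n (s n) (s (n + 1)) := by
  choose next h1 h2 using hs
  let t : ∀ n, {a : A n // Q n a} := fun n =>
    Nat.rec ⟨h0.choose, h0.choose_spec⟩ (fun n a => ⟨next n a.1 a.2, h1 n a.1 a.2⟩) n
  exact ⟨fun n => (t n).1, fun n => h2 n (t n).1 (t n).2⟩

/-! ### Null-homotopies built degree by degree -/

section Homotopy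

variable {B : Type u} [Category.{v} B] [Preadditive B]

/-- Morphisms `Y ⟶ Z` are null-homotopic if `Y` vanishes in negative degrees and the complexes
`B(Y, Z.X m)` are exact. -/
theorem nonempty_homotopy_zero_of_exact {Y Z : CochainComplex B ℤ}
    (hY : ∀ n : ℕ, IsZero (Y.X (Int.negSucc n)))
    (hYZ : ∀ (n : ℕ) (m : ℤ) (g : Y.X n ⟶ Z.X m), Y.d (n - 1) n ≫ g = 0 →
      ∃ h : Y.X (n + 1 : ℕ) ⟶ Z.X m, Y.d n (n + 1 : ℕ) ≫ h = g)
    (f : Y ⟶ Z) : Nonempty (Homotopy f 0) := by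
  -- The invariant says that the error left by `s n` is killed by the incoming differential;
  -- exactness then factors it through the outgoing one, which gives the next component.
  obtain ⟨s, hs⟩ := exists_dependent_sequence
    (A := fun n : ℕ => ∀ q : ℤ, (n : ℤ) + -1 = q → (Y.X n ⟶ Z.X q))
    (fun n s => Y.d (n - 1) n ≫ (f.f n - s (n - 1) rfl ≫ Z.d (n - 1) n) = 0)
    (fun n s t => f.f n = s (n - 1) rfl ≫ Z.d (n - 1) n + Y.d n (n + 1 : ℕ) ≫ t n (by simp))
    ⟨fun _ _ => 0, (hY 0).eq_of_src _ _⟩ (by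
      intro n s hn
      obtain ⟨h, hh⟩ := hYZ n n _ hn
      refine ⟨fun q hq => h ≫ (Z.XIsoOfEq (by lia)).hom, ?_, ?_⟩
      · have e : Y.d ((n + 1 : ℕ) - 1) (n + 1 : ℕ) = (Y.XIsoOfEq (by simp)).hom ≫
          Y.d n (n + 1 : ℕ) := by simp
        have e' : Z.d ((n + 1 : ℕ) - 1) (n + 1 : ℕ) = (Z.XIsoOfEq (by simp)).hom ≫
          Z.d n (n + 1 : ℕ) := by simp
        rw [e, e', Category.assoc, Preadditive.comp_sub, ← f.comm]
        simp only [Category.assoc, HomologicalComplex.XIsoOfEq_hom_comp_XIsoOfEq_hom_assoc,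
          HomologicalComplex.XIsoOfEq_rfl, Iso.refl_hom, Category.id_comp]
        rw [reassoc_of% hh]
        simp
      · dsimp only
        rw [HomologicalComplex.XIsoOfEq_rfl, Iso.refl_hom, Category.comp_id, hh, add_sub_cancel])
  refine ⟨(CochainComplex.HomComplex.Cochain.equivHomotopy f 0).symm
    ⟨CochainComplex.HomComplex.Cochain.mk fun p q hpq => match p, hpq with
      | Int.ofNat n, hpq => s n q hpq
      | Int.negSucc n, _ => 0, ?_⟩⟩
  refine CochainComplex.HomComplex.Cochain.ext₀ _ _ fun p => ?_
  cases p with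
  | negSucc n => exact (hY n).eq_of_src _ _
  | ofNat n =>
    rw [CochainComplex.HomComplex.Cochain.add_v,
      CochainComplex.HomComplex.δ_v (-1) 0 (by simp) _ (Int.ofNat n) (Int.ofNat n) (add_zero _)
        ((n : ℤ) - 1) (n + 1 : ℕ) rfl (by simp)]
    simp only [CochainComplex.HomComplex.Cochain.mk_v, Int.negOnePow_zero, one_smul,
      CochainComplex.HomComplex.Cochain.ofHom_v, HomologicalComplex.zero_f, add_zero]
    exact hs n

end Homotopy

/-! ### Coresolutions by powers of an object -/

section Coresolution

open ZeroObject

variable {B : Type u} [Category.{v} B] [Preadditive B] [HasZeroObject B] [HasProducts.{v} B]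
  (X M : B)

namespace ProductCoresolution

/-- The index type of the morphisms to `X` that are killed by `d`. -/
abbrev Killed {X P Q : B} (d : P ⟶ Q) : Type v := {g : Q ⟶ X // d ≫ g = 0}

/-- The differentials of the coresolution of `M` by products of copies of `X`, starting with
`0 ⟶ M`. -/
noncomputable def arrow : ℕ → Arrow B
  | 0 => Arrow.mk (0 : (0 : B) ⟶ M)
  | n + 1 => Arrow.mk (Pi.lift fun g : Killed (X := X) (arrow n).hom => g.1)

/-- The terms of the coresolution in nonnegative degrees. -/
noncomputable def term (n : ℕ) : B := (arrow X M n).right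

/-- The differential ending in degree `n`. -/
noncomputable def prev (n : ℕ) : (arrow X M n).left ⟶ term X M n := (arrow X M n).hom

/-- The differentials of the coresolution in nonnegative degrees. -/
noncomputable def diff (n : ℕ) : term X M n ⟶ term X M (n + 1) :=
  Pi.lift fun g : Killed (X := X) (prev X M n) => g.1

/-- The projections from the terms in positive degrees to `X`. -/
noncomputable def proj (n : ℕ) (k : Killed (X := X) (prev X M n)) : term X M (n + 1) ⟶ X :=
  Pi.π (fun _ : Killed (X := X) (prev X M n) => X) k

lemma diff_proj (n : ℕ) (k : Killed (X := X) (prev X M n)) : diff X M n ≫ proj X M n k = k.1 :=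
  Pi.lift_π (fun g : Killed (X := X) (prev X M n) => g.1) k

lemma prev_comp_diff (n : ℕ) : prev X M n ≫ diff X M n = 0 := by
  refine Pi.hom_ext (f := fun _ : Killed (X := X) (prev X M n) => X) _ _ fun k => ?_
  change (prev X M n ≫ diff X M n) ≫ proj X M n k = 0 ≫ proj X M n k
  rw [zero_comp, Category.assoc, diff_proj, k.2]

lemma diff_comp_diff (n : ℕ) : diff X M n ≫ diff X M (n + 1) = 0 := prev_comp_diff X M (n + 1)

variable {X} in
-- A map to `X` killed by the previous differential is itself an index of the next product, and the
-- projection at that index extends it.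
lemma exists_diff_comp_eq {n : ℕ} {W : B} (r : Retract W X) (g : term X M n ⟶ W)
    (hg : prev X M n ≫ g = 0) : ∃ h : term X M (n + 1) ⟶ W, diff X M n ≫ h = g :=
  ⟨proj X M n ⟨g ≫ r.i, by rw [reassoc_of% hg, zero_comp]⟩ ≫ r.r, by
    rw [← Category.assoc, diff_proj, Category.assoc, r.retract, Category.comp_id]⟩

/-- The terms of the coresolution. -/
noncomputable def X' : ℤ → B
  | Int.ofNat n => term X M n
  | Int.negSucc _ => 0

/-- The differentials of the coresolution. -/
noncomputable def d' : ∀ n : ℤ, X' X M n ⟶ X' X M (n + 1)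
  | Int.ofNat n => diff X M n
  | Int.negSucc _ => 0

/-- A complex `M ⟶ P₁ ⟶ P₂ ⟶ ⋯` with `M` in degree zero, all `Pᵢ` products of copies of `X`,
on which `B(-, X)` is exact. -/
noncomputable def complex : CochainComplex B ℤ :=
  CochainComplex.of (X' X M) (d' X M) fun n => by
    cases n with
    | ofNat n => exact diff_comp_diff X M n
    | negSucc n => exact zero_comp

lemma complex_d (n : ℕ) : (complex X M).d n (n + 1 : ℕ) = diff X M n :=
  CochainComplex.of_d (X' X M) (d' X M) n

lemma isZero_complex_X (n : ℕ) : IsZero ((complex X M).X (Int.negSucc n)) := isZero_zero B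

variable {X} in
theorem nonempty_homotopy_zero {Z : CochainComplex B ℤ} (hZ : ∀ n, Nonempty (Retract (Z.X n) X))
    (f : complex X M ⟶ Z) : Nonempty (Homotopy f 0) := by
  refine nonempty_homotopy_zero_of_exact (isZero_complex_X X M) (fun n m g hg => ?_) f
  rw [complex_d]
  refine exists_diff_comp_eq M (hZ m).some g ?_
  cases n with
  | zero => exact IsZero.eq_of_src (isZero_zero B) (Y := Z.X m) _ _
  | succ n =>
    have : ((n + 1 : ℕ) : ℤ) - 1 = n := by simp
    rw [this, complex_d] at hg
    exact hg

/-- As the term in degree `-1` vanishes, the homotopy identity in degree `0` splits the first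
differential. -/
lemma nonempty_retract_of_homotopy_zero (h : Homotopy (𝟙 (complex X M)) 0) :
    Nonempty (Retract M (term X M 1)) := by
  have h0 := CochainComplex.HomComplex.Cochain.congr_v
    (CochainComplex.HomComplex.Cochain.equivHomotopy _ _ h).2 0 0 rfl
  rw [CochainComplex.HomComplex.Cochain.add_v,
      CochainComplex.HomComplex.δ_v (-1) 0 (by simp) _ _ _ _ (-1) (0 + 1 : ℕ) rfl rfl] at h0
  have h1 : (complex X M).d 0 (0 + 1 : ℕ) = diff X M 0 := complex_d X M 0
  rw [h1, (isZero_complex_X X M 0).eq_of_src ((complex X M).d (-1) 0) 0] at h0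
  refine ⟨diff X M 0, ?_, ?_⟩
  · exact (CochainComplex.HomComplex.Cochain.equivHomotopy _ _ h).1.v (0 + 1 : ℕ) 0 (by simp)
  · replace h0 := h0.symm
    simp only [comp_zero, zero_add, Int.negOnePow_zero, one_smul,
      CochainComplex.HomComplex.Cochain.ofHom_v, HomologicalComplex.zero_f, add_zero,
      HomologicalComplex.id_f] at h0
    exact h0

lemma prodClosure_of_isZero [HasBinaryBiproducts B]
    (h : IsZero ((HomotopyCategory.quotient B (ComplexShape.up ℤ)).obj (complex X M))) :
    ProdClosure (fun Y => Y = X) M := by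
  rw [HomotopyCategory.isZero_quotient_obj_iff] at h
  obtain ⟨r⟩ := nonempty_retract_of_homotopy_zero X M h.some
  exact .of_retract r (.product _ (limit.isLimit _) fun _ => .of_mem rfl)

end ProductCoresolution

end Coresolution

theorem BrownRepresentabilityForDual.hasProductGenerator
    {B : Type u} [Category.{v} B] [Preadditive B] [HasZeroObject B]
    [HasBinaryBiproducts B] [HasProducts.{v} B] (hB : ObjectsIndexedByOrdinals B)
    (h : BrownRepresentabilityForDual (HomotopyCategory B (ComplexShape.up ℤ))) :
    HasProductGenerator B := by
  obtain ⟨f, hf⟩ := hB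
  by_contra hgen
  simp only [HasProductGenerator, not_exists, not_forall] at hgen
  choose M hM using hgen
  let X (γ : Ordinal.{v}) : B :=
    ∏ᶜ fun β : Shrink.{v} (Set.Iio γ) => f ((equivShrink (Set.Iio γ)).symm β)
  have retract {β γ : Ordinal.{v}} (hβ : β < γ) : Nonempty (Retract (f β) (X γ)) := by
    have e : f ((equivShrink (Set.Iio γ)).symm (equivShrink _ ⟨β, hβ⟩)) = f β := by simp
    rw [← e]
    exact ⟨⟨Pi.ι (fun β : Shrink.{v} (Set.Iio γ) => f ((equivShrink (Set.Iio γ)).symm β)) _, Pi.π _ _,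
      Pi.ι_π_eq_id _ _⟩⟩
  -- A complex has countably many terms, so one ordinal bounds the indices of all of them.
  have bound (Z : HomotopyCategory B (ComplexShape.up ℤ)) :
      ∃ γ₀ : Ordinal.{v}, ∀ γ, γ₀ ≤ γ → ∀ g : (HomotopyCategory.quotient B _).obj
        (ProductCoresolution.complex (X γ) (M (X γ))) ⟶ Z, g = 0 := by
    obtain ⟨Z, rfl⟩ := HomotopyCategory.quotient_obj_surjective Z
    choose β hβ using fun n => hf (Z.X n)
    refine ⟨⨆ n, Order.succ (β n), fun γ hγ g => ?_⟩
    obtain ⟨g, rfl⟩ := (HomotopyCategory.quotient B _).map_surjective g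
    have hZ (n : ℤ) : Nonempty (Retract (Z.X n) (X γ)) := by
      have hn : β n < γ := (Order.lt_succ _).trans_le
        ((le_ciSup Ordinal.bddAbove_of_small n).trans hγ)
      exact ⟨(Retract.ofIso (hβ n).some.symm).trans (retract hn).some⟩
    obtain ⟨H⟩ := ProductCoresolution.nonempty_homotopy_zero (M (X γ)) hZ g
    rw [HomotopyCategory.eq_of_homotopy _ _ H, Functor.map_zero]
  choose γ₀ hγ₀ using bound
  obtain ⟨Z, hZ⟩ := h.exists_forall_isZero (fun γ : Ordinal.{v} =>
    (HomotopyCategory.quotient B _).obj (ProductCoresolution.complex (X γ) (M (X γ))))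
    (fun Z => by
      refine small_subset (s := Set.Iio (γ₀ Z)) fun γ ⟨g, hg⟩ => ?_
      by_contra hγ
      exact hg (hγ₀ Z γ (not_lt.1 hγ) g))
  exact hM _ (ProductCoresolution.prodClosure_of_isZero _ _ (hZ (γ₀ Z) (hγ₀ Z _ le_rfl)))

/-! ### Indexing abelian groups by ordinals -/

open Cardinal in
theorem mk_sigma_ordinal_le (F : Ordinal.{v} → Type v) :
    #(Σ o, F o) ≤ #Ordinal.{v} := by
  have h1 (o : Ordinal.{v}) : lift.{v + 1} #(F o) ≤ univ.{v, v + 1} := (lift_lt_univ _).le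
  calc #(Σ o, F o) = #(Σ o, ULift.{v + 1} (F o)) :=
        mk_congr (Equiv.sigmaCongrRight fun o => Equiv.ulift.symm)
    _ = sum fun o => #(ULift.{v + 1} (F o)) := mk_sigma _
    _ ≤ sum fun _ : Ordinal.{v} => univ.{v, v + 1} := sum_le_sum _ _ fun o => by
        rw [mk_uLift]; exact h1 o
    _ = #Ordinal.{v} * univ.{v, v + 1} := sum_const' _ _
    _ = #Ordinal.{v} := by
        rw [mk_ordinal]
        exact mul_eq_self (aleph0_lt_univ).le

theorem AddCommGrpCat.objectsIndexedByOrdinals :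
    ObjectsIndexedByOrdinals AddCommGrpCat.{v} := by
  -- `Function.invFun` needs a default value; the trivial group serves.
  have : Nonempty (Σ o : Ordinal.{v}, AddCommGroup o.ToType) :=
    ⟨⟨_, Equiv.addCommGroup (α := (Cardinal.mk PUnit.{v + 1}).ord.ToType)
      (β := PUnit.{v + 1}) (Cardinal.eq.1 (by simp)).some⟩⟩
  obtain ⟨e⟩ := Cardinal.le_def _ _ |>.1
    (mk_sigma_ordinal_le fun o : Ordinal.{v} => AddCommGroup o.ToType)
  refine ⟨fun o => let x := Function.invFun e o; @AddCommGrpCat.of x.1.ToType x.2, fun A => ?_⟩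
  obtain ⟨ε⟩ : Nonempty ((Cardinal.mk A).ord.ToType ≃ A) := Cardinal.eq.1 (by simp)
  let := ε.addCommGroup
  refine ⟨e ⟨(Cardinal.mk A).ord, inferInstance⟩, ⟨?_⟩⟩
  dsimp only
  rw [Function.leftInverse_invFun e.injective]
  exact AddEquiv.toAddCommGrpIso (X := AddCommGrpCat.of (Cardinal.mk A).ord.ToType) (Y := A)
    ε.addEquiv

/-! ### Infinite chains of halvings -/

/-- `x` is the start of an infinite sequence of successive divisions by two. -/
def HasTwoDivisionChain {A : Type*} [AddCommGroup A] (x : A) : Prop :=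
  ∃ s : ℕ → A, s 0 = x ∧ ∀ n, 2 • s (n + 1) = s n

lemma HasTwoDivisionChain.map {A C : Type*} [AddCommGroup A] [AddCommGroup C] {x : A}
    (hx : HasTwoDivisionChain x) (φ : A →+ C) : HasTwoDivisionChain (φ x) := by
  obtain ⟨s, h0, hs⟩ := hx
  exact ⟨φ ∘ s, congrArg φ h0, fun n => by
    rw [Function.comp_apply, Function.comp_apply, ← hs n, map_nsmul]⟩

lemma hasTwoDivisionChain_of_not_acc {A : Type*} [AddCommGroup A] {x : A}
    (hx : ¬ Acc (fun y z : A => 2 • y = z) x) : HasTwoDivisionChain x := by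
  have step (y : {y : A // ¬ Acc (fun y z : A => 2 • y = z) y}) :
      ∃ z : {y : A // ¬ Acc (fun y z : A => 2 • y = z) y}, 2 • z.1 = y.1 := by
    by_contra! h
    exact y.2 ⟨_, fun z hz => by_contra fun hz' => h ⟨z, hz'⟩ hz⟩
  choose next hnext using step
  refine ⟨fun n => (next^[n] ⟨x, hx⟩).1, rfl, fun n => ?_⟩
  change 2 • (next^[n + 1] ⟨x, hx⟩).1 = _
  rw [Function.iterate_succ_apply', hnext]

/-- Every sequence of successive divisions by two in `A / S` is zero. -/
def TwoReducedMod {A : Type*} [AddCommGroup A] (S : AddSubgroup A) : Prop :=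
  ∀ s : ℕ → A, (∀ n, 2 • s (n + 1) - s n ∈ S) → ∀ n, s n ∈ S

/-- A pointed abelian group `(A, a)` such that `A / 2a` is reduced with respect to two and some
homomorphism to the rational numbers does not kill `a`. -/
structure IsTwoReducedAt {A : Type*} [AddCommGroup A] (a : A) : Prop where
  exists_hom : ∃ ψ : A →+ ℚ, ψ a = 1
  reduced : TwoReducedMod (AddSubgroup.zmultiples (2 • a))

/-- A chain from `a` would give `a = 2ka`, and the homomorphism to `ℚ` turns this into `2k = 1`. -/
lemma IsTwoReducedAt.not_hasTwoDivisionChain {A : Type*} [AddCommGroup A] {a : A}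
    (ha : IsTwoReducedAt a) : ¬ HasTwoDivisionChain a := by
  rintro ⟨s, h0, hs⟩
  have h := ha.reduced s (fun n => by rw [hs, sub_self]; exact zero_mem _) 0
  rw [h0] at h
  obtain ⟨k, hk⟩ := AddSubgroup.mem_zmultiples_iff.1 h
  obtain ⟨ψ, hψ⟩ := ha.exists_hom
  have h1 := congrArg ψ hk
  rw [map_zsmul, map_nsmul, hψ] at h1
  have h2 : k * 2 = 1 := by
    have : ((k * 2 : ℤ) : ℚ) = (1 : ℤ) := by simpa using h1
    exact_mod_cast this
  omega

/-! ### Gluing pointed groups along twice their points -/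

section Gluing

variable {J : Type v} [DecidableEq J] {G : J → Type v} [∀ j, AddCommGroup (G j)] (g : ∀ j, G j)

/-- The relations that identify all the elements `2 • g j` with the generator `1 : ℤ`. -/
def gluingRelations : AddSubgroup ((Π₀ j, G j) × ℤ) :=
  AddSubgroup.closure (Set.range fun j => (DFinsupp.single j (2 • g j), -1))

/-- The abelian group obtained from `⨁ j, G j` by adding an element that is equal to all
the elements `2 • g j`. -/
abbrev Gluing : Type v := ((Π₀ j, G j) × ℤ) ⧸ gluingRelations g

/-- The common value of the elements `2 • g j`. -/
def gluingPoint : Gluing g := QuotientAddGroup.mk (0, 1)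

/-- The canonical map from a summand. -/
def gluingInclusion (j : J) : G j →+ Gluing g :=
  (QuotientAddGroup.mk' _).comp ((AddMonoidHom.inl _ _).comp (DFinsupp.singleAddHom G j))

lemma two_nsmul_gluingInclusion (j : J) : 2 • gluingInclusion g j (g j) = gluingPoint g := by
  rw [← map_nsmul]
  refine (QuotientAddGroup.eq_iff_sub_mem).2 (AddSubgroup.subset_closure ⟨j, ?_⟩)
  simp

variable {g} in
/-- Homomorphisms from a gluing. -/
def gluingLift {A : Type*} [AddCommGroup A] (φ : ∀ j, G j →+ A) (a : A)
    (h : ∀ j, 2 • φ j (g j) = a) : Gluing g →+ A :=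
  QuotientAddGroup.lift _
    ((DFinsupp.liftAddHom φ).coprod (zmultiplesHom A a)) <| by
      rw [gluingRelations, AddSubgroup.closure_le]
      rintro _ ⟨j, rfl⟩
      simp [h]

lemma gluingLift_mk {A : Type*} [AddCommGroup A] (φ : ∀ j, G j →+ A) (a : A)
    (h : ∀ j, 2 • φ j (g j) = a) (y : Π₀ j, G j) (k : ℤ) :
    gluingLift φ a h (QuotientAddGroup.mk (y, k)) = DFinsupp.liftAddHom φ y + k • a := rfl

lemma gluingInclusion_sum (y : Π₀ j, G j) (k : ℤ) :
    (QuotientAddGroup.mk (y, k) : Gluing g) =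
      DFinsupp.liftAddHom (gluingInclusion g) y + k • gluingPoint g := by
  have h1 : (QuotientAddGroup.mk' (gluingRelations g)).comp (AddMonoidHom.inl _ _) =
      DFinsupp.liftAddHom (gluingInclusion g) :=
    DFinsupp.addHom_ext fun j a => by
      rw [DFinsupp.liftAddHom_apply, DFinsupp.sumAddHom_single]; rfl
  have h2 : (QuotientAddGroup.mk' (gluingRelations g)).comp (AddMonoidHom.inr _ _) =
      zmultiplesHom _ (gluingPoint g) :=
    AddMonoidHom.ext_int (by simp [gluingPoint])
  have h := AddMonoidHom.coprod_unique (QuotientAddGroup.mk' (gluingRelations g))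
  rw [h1, h2] at h
  exact (DFunLike.congr_fun h (y, k)).symm

variable {g} in
-- Modulo its point the gluing is the sum of the `G j / 2 g j`, so chains modulo twice the point lie
-- in the multiples of the point; one halving step improves this to multiples of twice the point.
theorem IsTwoReducedAt.gluingPoint (hg : ∀ j, IsTwoReducedAt (g j)) :
    IsTwoReducedAt (gluingPoint g) := by
  constructor
  · choose ψ hψ using fun j => (hg j).exists_hom
    refine ⟨gluingLift (fun j => (AddMonoidHom.mulLeft (1 / 2 : ℚ)).comp (ψ j)) 1
      (by simp [hψ]), ?_⟩
    rw [_root_.gluingPoint, gluingLift_mk]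
    simp
  · intro s hs
    suffices h : ∀ n, s n ∈ AddSubgroup.zmultiples (_root_.gluingPoint g) by
      intro n
      have h1 : 2 • s (n + 1) ∈ AddSubgroup.zmultiples (2 • _root_.gluingPoint g) := by
        obtain ⟨k, hk⟩ := AddSubgroup.mem_zmultiples_iff.1 (h (n + 1))
        exact AddSubgroup.mem_zmultiples_iff.2 ⟨k, by
          rw [← hk, ← natCast_zsmul, ← natCast_zsmul, smul_smul, smul_smul, mul_comm]⟩
      simpa using sub_mem h1 (hs n)
    choose y hy using fun n => QuotientAddGroup.mk_surjective (s n)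
    let π (j : J) : Gluing g →+ G j ⧸ AddSubgroup.zmultiples (2 • g j) :=
      gluingLift (Pi.single j (QuotientAddGroup.mk' _)) 0 (fun i => by
        by_cases hi : i = j
        · subst hi
          rw [Pi.single_eq_same, ← map_nsmul]
          exact (QuotientAddGroup.eq_zero_iff _).2 (AddSubgroup.mem_zmultiples _)
        · rw [Pi.single_eq_of_ne hi]; simp)
    have hπ (j : J) (n : ℕ) : π j (s n) = QuotientAddGroup.mk ((y n).1 j) := by
      have h : DFinsupp.liftAddHom (Pi.single j
          (QuotientAddGroup.mk' (AddSubgroup.zmultiples (2 • g j)))) =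
          (QuotientAddGroup.mk' _).comp (DFinsupp.evalAddMonoidHom j) := by
        refine DFinsupp.addHom_ext fun i a => ?_
        rw [DFinsupp.liftAddHom_apply, DFinsupp.sumAddHom_single]
        change _ = QuotientAddGroup.mk' _ (DFinsupp.single i a j)
        by_cases hi : i = j
        · subst hi
          rw [Pi.single_eq_same, DFinsupp.single_eq_same]
        · rw [Pi.single_eq_of_ne hi, DFinsupp.single_eq_of_ne (Ne.symm hi), map_zero,
            AddMonoidHom.zero_apply]
      rw [← hy n]
      refine (gluingLift_mk g _ _ _ (y n).1 (y n).2).trans ?_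
      rw [h, smul_zero, add_zero]
      rfl
    have hπs (j : J) (n : ℕ) : (y n).1 j ∈ AddSubgroup.zmultiples (2 • g j) := by
      refine (hg j).reduced (fun n => (y n).1 j) (fun n => ?_) n
      have h1 : π j (2 • s (n + 1) - s n) = 0 := by
        obtain ⟨k, hk⟩ := AddSubgroup.mem_zmultiples_iff.1 (hs n)
        have h2 : π j (_root_.gluingPoint g) = 0 := by
          simp [π, _root_.gluingPoint, gluingLift_mk]
        rw [← hk, map_zsmul, map_nsmul, h2, smul_zero, smul_zero]
      rw [map_sub, map_nsmul, hπ, hπ] at h1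
      exact (QuotientAddGroup.eq_zero_iff _).1 h1
    intro n
    rw [← hy n, gluingInclusion_sum]
    refine add_mem ?_ (zsmul_mem (AddSubgroup.mem_zmultiples _) _)
    rw [DFinsupp.liftAddHom_apply]
    refine dfinsuppSumAddHom_mem _ _ _ fun j _ => ?_
    obtain ⟨k, hk⟩ := AddSubgroup.mem_zmultiples_iff.1 (hπs j n)
    rw [← hk, map_zsmul, map_nsmul, two_nsmul_gluingInclusion]
    exact zsmul_mem (AddSubgroup.mem_zmultiples _) _

end Gluing

/-- By induction, glue the groups attached to all halves `y` of `x`: their points map to halves of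
the image of the gluing point, of rank at least that of `y`. -/
theorem exists_isTwoReducedAt_rank_le (X : Type v) [AddCommGroup X] (x : X)
    (hx : Acc (fun y z : X => 2 • y = z) x) :
    ∃ (G : Type v) (_ : AddCommGroup G) (g : G), IsTwoReducedAt g ∧
      ∀ φ : G →+ X, ∀ h : Acc (fun y z : X => 2 • y = z) (φ g), hx.rank ≤ h.rank := by
  classical
  induction hx with
  | intro x hx ih =>
    choose G inst g hg hφ using ih
    let G' (y : {y : X // 2 • y = x}) : Type v := G y.1 y.2
    let : ∀ y, AddCommGroup (G' y) := fun y => inst y.1 y.2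
    let g' (y : {y : X // 2 • y = x}) : G' y := g y.1 y.2
    refine ⟨Gluing g', inferInstance, gluingPoint g',
      .gluingPoint fun y => hg y.1 y.2, fun φ h => ?_⟩
    rw [Acc.rank_eq]
    refine Ordinal.iSup_le fun y => Order.succ_le_of_lt ?_
    have hr : 2 • (φ.comp (gluingInclusion g' y)) (g' y) = φ (gluingPoint g') := by
      rw [AddMonoidHom.comp_apply, ← map_nsmul, two_nsmul_gluingInclusion]
    exact (hφ y.1 y.2 (φ.comp (gluingInclusion g' y)) (h.inv hr)).trans_lt (Acc.rank_lt_of_rel h hr)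

/-- Every abelian group `X` admits a pointed abelian group without infinite divisions of the point
by two, whose homomorphisms to `X` send the point to infinitely two-divisible elements. -/
theorem exists_hasTwoDivisionChain_map (X : Type v) [AddCommGroup X] :
    ∃ (G : Type v) (_ : AddCommGroup G) (g : G), ¬ HasTwoDivisionChain g ∧
      ∀ φ : G →+ X, HasTwoDivisionChain (φ g) := by
  classical
  choose G inst g hg hφ using fun y : {y : X // Acc (fun y z : X => 2 • y = z) y} =>
    exists_isTwoReducedAt_rank_le X y.1 y.2
  refine ⟨Gluing g, inferInstance, gluingPoint g,
    (IsTwoReducedAt.gluingPoint hg).not_hasTwoDivisionChain, fun φ =>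
      hasTwoDivisionChain_of_not_acc fun h => ?_⟩
  -- The summand indexed by the value `φ (gluingPoint g)` itself has its point sent to a half of
  -- that value, hence to an element of smaller rank, against the choice of the summand.
  have hr : 2 • (φ.comp (gluingInclusion g ⟨_, h⟩)) (g ⟨_, h⟩) = φ (gluingPoint g) := by
    rw [AddMonoidHom.comp_apply, ← map_nsmul, two_nsmul_gluingInclusion]
  exact absurd (Acc.rank_lt_of_rel h hr) (hφ ⟨_, h⟩ _ (h.inv hr)).not_gt

lemma ProdClosure.hasTwoDivisionChain_map {X M : AddCommGrpCat.{v}} {G : Type v} [AddCommGroup G]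
    {g : G} (hX : ∀ φ : G →+ X, HasTwoDivisionChain (φ g))
    (hM : ProdClosure (fun Y => Y = X) M) (φ : G →+ M) : HasTwoDivisionChain (φ g) := by
  induction hM with
  | of_mem h => subst h; exact hX φ
  | @product J f c hc _ ih =>
    choose s h0 hs using fun j => ih j ((c.proj j).hom.comp φ)
    have ext {a b : c.pt} (h : ∀ j, c.proj j a = c.proj j b) : a = b :=
      Concrete.isLimit_ext _ hc _ _ fun j => h j.as
    -- Chains chosen in the factors are assembled in the abstract product through maps out of `ℤ`.
    let t (n : ℕ) : AddCommGrpCat.of (ULift.{v} ℤ) ⟶ c.pt := Fan.IsLimit.lift hc fun j =>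
      AddCommGrpCat.ofHom ((zmultiplesHom (f j) (s j n)).comp AddEquiv.ulift.toAddMonoidHom)
    have ht (n : ℕ) (j : J) : c.proj j (t n ⟨1⟩) = s j n := by
      have := ConcreteCategory.congr_hom (Fan.IsLimit.fac hc (fun j =>
        AddCommGrpCat.ofHom ((zmultiplesHom (f j) (s j n)).comp AddEquiv.ulift.toAddMonoidHom)) j)
          ⟨1⟩
      exact this.trans (one_zsmul _)
    refine ⟨fun n => t n ⟨1⟩, ext fun j => ?_, fun n => ext fun j => ?_⟩
    · rw [ht, h0]; rfl
    · rw [map_nsmul, ht, ht, hs]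
  | @summand Z M N e _ ih =>
    have h := (ih ((biprod.inl ≫ e.inv).hom.comp φ)).map (e.hom ≫ biprod.fst).hom
    have : (biprod.inl ≫ e.inv) ≫ e.hom ≫ biprod.fst = 𝟙 M := by simp
    have h2 := ConcreteCategory.congr_hom this (φ g)
    exact h2 ▸ h

theorem AddCommGrpCat.not_hasProductGenerator : ¬ HasProductGenerator AddCommGrpCat.{v} := by
  rintro ⟨X, hX⟩
  obtain ⟨G, _, g, hg, hφ⟩ := exists_hasTwoDivisionChain_map X
  exact hg ((hX (AddCommGrpCat.of G)).hasTwoDivisionChain_map hφ (AddMonoidHom.id G))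

theorem mainTheorem2 :
    (∀ (B : Type u) [Category.{v} B] [Preadditive B] [HasZeroObject B]
        [HasBinaryBiproducts B] [HasProducts.{v} B],
        ObjectsIndexedByOrdinals B →
        BrownRepresentabilityForDual (HomotopyCategory B (ComplexShape.up ℤ)) →
        HasProductGenerator B) ∧
      ¬ HasProductGenerator AddCommGrpCat.{v} ∧
      ¬ BrownRepresentabilityForDual
          (HomotopyCategory AddCommGrpCat.{v} (ComplexShape.up ℤ)) :=
  ⟨fun _ _ _ _ _ _ hB h => h.hasProductGenerator hB,
    AddCommGrpCat.not_hasProductGenerator,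
    fun h => AddCommGrpCat.not_hasProductGenerator
      (h.hasProductGenerator AddCommGrpCat.objectsIndexedByOrdinals)⟩
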